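/- Let $G$ be a finite, simple, undirected, connected graph on $n\ge 2$ vertices with a positive real weight on each edge. Its Laplacian matrix $L(G)$ has as its $i$-th diagonal entry the weighted degree of $i$ (the sum of the weights of the edges at $i$), has $(i,j)$ entry minus the weight of the edge $ij$ if $i\ne j$ are adjacent, and has all other entries $0$. Let $v$ be a vertex of $G$ that is not a cut-vertex, that is, deleting $v$ and its incident edges does not leave two or more connected components. Let $M$ be the bottleneck matrix at $v$, i.e. the inverse of the $(n-1)\times(n-1)$ matrix obtained from $L(G)$ by deleting the row and the column of $v$, and let $\rho(M)$ be its spectral radius. Let $x\in\mathbb{R}^{n-1}$ have only positive entries, and suppose that $x$ is not a Perron vector of $M$, i.e. not an eigenvector of $M$ for the eigenvalue $\rho(M)$. For integers $k\ge 1$ put $$a_k(M,x)=\max_i\frac{(M^kx)_i}{(M^{k-1}x)_i},\qquad b_k(M,x)=\min_i\frac{(M^kx)_i}{(M^{k-1}x)_i},\qquad c_k(M,x)=\frac{x^TM^kx}{x^TM^{k-1}x}.$$ Then $(a_k(M,x))_{k\ge1}$ is strictly decreasing and converges to $\rho(M)$, whereas $(b_k(M,x))_{k\ge1}$ and $(c_k(M,x))_{k\ge1}$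 are strictly increasing and converge to $\rho(M)$. -/

import Mathlib

open Filter Topology Matrix

noncomputable section

/-- `v` is a cut-vertex of `G`: deleting `v` and all incident edges leaves at least two connected
components. -/
def IsCutVertex {V : Type*} (G : SimpleGraph V) (v : V) : Prop :=
  Nontrivial (G.induce {u | u ≠ v}).ConnectedComponent

/-- The Laplacian matrix of the graph `G` with edge weights `w`: the `i`-th diagonal entry is the
weighted degree of `i`, and the `(i, j)` entry is minus the weight of the edge `ij`, or `0` if
there is no such edge. -/
def weightedLaplacian {V : Type*} [Fintype V] [DecidableEq V] (G : SimpleGraph V)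
    [DecidableRel G.Adj] (w : Sym2 V → ℝ) : Matrix V V ℝ :=
  Matrix.of fun i j =>
    if i = j then ∑ u ∈ G.neighborFinset i, w s(i, u)
    else if G.Adj i j then -w s(i, j) else 0

/-- The bottleneck matrix at `v`: the inverse of the Laplacian with the row and the column of `v`
deleted. -/
def bottleneckMatrix {V : Type*} [Fintype V] [DecidableEq V] (G : SimpleGraph V)
    [DecidableRel G.Adj] (w : Sym2 V → ℝ) (v : V) : Matrix {u // u ≠ v} {u // u ≠ v} ℝ :=
  ((weightedLaplacian G w).submatrix Subtype.val Subtype.val)⁻¹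

variable {n : Type*} [Fintype n] [DecidableEq n]

/-- The Perron value: the spectral radius, that is, the largest modulus of a complex eigenvalue. -/
def perronValue (A : Matrix n n ℝ) : ℝ :=
  (spectralRadius ℂ (A.map (algebraMap ℝ ℂ))).toReal

/-- A Perron vector: a (nonzero) eigenvector associated with the Perron value. -/
def IsPerronVector (A : Matrix n n ℝ) (x : n → ℝ) : Prop :=
  Module.End.HasEigenvector (Matrix.toLin' A) (perronValue A) x

/-- `a_k(A, x) = max_i (A^k x)_i / (A^(k-1) x)_i`, for `k ≥ 1`. -/
def aSeq (A : Matrix n n ℝ) (x : n → ℝ) (k : ℕ) : ℝ :=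
  ⨆ i, (A ^ k *ᵥ x) i / (A ^ (k - 1) *ᵥ x) i

/-- `b_k(A, x) = min_i (A^k x)_i / (A^(k-1) x)_i`, for `k ≥ 1`. -/
def bSeq (A : Matrix n n ℝ) (x : n → ℝ) (k : ℕ) : ℝ :=
  ⨅ i, (A ^ k *ᵥ x) i / (A ^ (k - 1) *ᵥ x) i

/-- `c_k(A, x) = (xᵀ A^k x) / (xᵀ A^(k-1) x)`, for `k ≥ 1`. -/
def cSeq (A : Matrix n n ℝ) (x : n → ℝ) (k : ℕ) : ℝ :=
  (x ⬝ᵥ A ^ k *ᵥ x) / (x ⬝ᵥ A ^ (k - 1) *ᵥ x)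

end

/-! ### Ratio bounds for iterates of an entrywise positive matrix. -/

section PositiveMatrix

/-! The bottleneck matrix is entrywise positive and positive definite; the rest holds for every such
`A`. Positivity is a minimum principle for the reduced Laplacian (`eq_zero_or_pos_of_nonneg`),
applied to the columns of the inverse; there the non-cut-vertex hypothesis enters. With `y = A ^ k
x` and `a`, `b` its extreme ratios, `a y - A y` and `A y - b y` are nonnegative. If they are
nonzero, `A` makes them strictly positive, so `a` drops and `b` rises. If one vanishes, `y`, hence
`x`, is an eigenvector, and a positive eigenvector is a Perron vector. The gap `a - b` shrinks
geometrically (`exists_aSeq_sub_bSeq_le`) and always encloses the Perron value (Collatz–Wielandt),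
which gives the limits. The Rayleigh-type quotient `c` is squeezed between them; it increases by
strict Cauchy–Schwarz for the form of `A ^ k` (`cSeq_lt_succ`). -/

theorem mulVec_apply_pos {n : Type*} [Fintype n] {A : Matrix n n ℝ} (hA : ∀ i j, 0 < A i j)
    {u : n → ℝ} (hu : ∀ i, 0 ≤ u i) (hne : u ≠ 0) (i : n) : 0 < (A *ᵥ u) i := by
  obtain ⟨j, hj⟩ := Function.ne_iff.1 hne
  exact Finset.sum_pos' (fun l _ => mul_nonneg (hA i l).le (hu l))
    ⟨j, Finset.mem_univ j, mul_pos (hA i j) ((hu j).lt_of_ne' hj)⟩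

theorem pow_succ_mulVec {n : Type*} [Fintype n] [DecidableEq n] (A : Matrix n n ℝ) (x : n → ℝ)
    (k : ℕ) : A ^ (k + 1) *ᵥ x = A *ᵥ (A ^ k *ᵥ x) := by
  rw [pow_succ', mulVec_mulVec]

theorem pow_mulVec_pos {n : Type*} [Fintype n] [DecidableEq n] {A : Matrix n n ℝ}
    (hA : ∀ i j, 0 < A i j) {x : n → ℝ} (hx : ∀ i, 0 < x i) (k : ℕ) (i : n) :
    0 < (A ^ k *ᵥ x) i := by
  induction k generalizing i with
  | zero => simpa using hx i
  | succ k ih =>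
    rw [pow_succ_mulVec]
    exact mulVec_apply_pos hA (fun i => (ih i).le) (fun h => (ih i).ne' (congrFun h i)) i

theorem exists_pos_forall_le {ι : Type*} [Finite ι] {f : ι → ℝ} (hf : ∀ i, 0 < f i) :
    ∃ c, 0 < c ∧ ∀ i, c ≤ f i := by
  cases isEmpty_or_nonempty ι
  · exact ⟨1, one_pos, isEmptyElim⟩
  · obtain ⟨i, hi⟩ := Finite.exists_min f
    exact ⟨f i, hf i, hi⟩

/-- The entries of the iterates of a positive matrix on a positive vector are uniformly
comparable. -/
theorem exists_pos_mul_pow_mulVec_le {n : Type*} [Fintype n] [DecidableEq n] {A : Matrix n n ℝ}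
    (hA : ∀ i j, 0 < A i j) {x : n → ℝ} (hx : ∀ i, 0 < x i) :
    ∃ c, 0 < c ∧ ∀ k i j, c * (A ^ k *ᵥ x) i ≤ (A ^ k *ᵥ x) j := by
  obtain ⟨c₀, hc₀, h₀⟩ := exists_pos_forall_le (f := fun p : n × n => x p.2 / x p.1)
    fun p => div_pos (hx _) (hx _)
  obtain ⟨c₁, hc₁, h₁⟩ := exists_pos_forall_le
    (f := fun p : n × n × n => A p.2.1 p.2.2 / A p.1 p.2.2)
    fun p => div_pos (hA _ _) (hA _ _)
  -- `c₀` serves `k = 0`; `c₁` compares two rows of `A` and so serves every later iterate.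
  refine ⟨min c₀ c₁, lt_min hc₀ hc₁, fun k i j => ?_⟩
  have hmin : min c₀ c₁ ≤ if k = 0 then c₀ else c₁ := by split_ifs <;> simp
  refine (mul_le_mul_of_nonneg_right hmin (pow_mulVec_pos hA hx k i).le).trans ?_
  cases k with
  | zero => simpa using (le_div_iff₀ (hx i)).1 (h₀ (i, j))
  | succ k =>
    simp only [Nat.add_eq_zero_iff, one_ne_zero, and_false, if_false, pow_succ_mulVec]
    rw [mulVec, dotProduct, mulVec, dotProduct, Finset.mul_sum]
    simp only [← mul_assoc]
    exact Finset.sum_le_sum fun l _ => mul_le_mul_of_nonneg_right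
      ((le_div_iff₀ (hA i l)).1 (h₁ (i, j, l))) (pow_mulVec_pos hA hx k l).le

theorem exists_pos_mul_pow_succ_mulVec_le {n : Type*} [Fintype n] [DecidableEq n] [Nonempty n]
    {A : Matrix n n ℝ} (hA : ∀ i j, 0 < A i j) {x : n → ℝ} (hx : ∀ i, 0 < x i) :
    ∃ δ, 0 < δ ∧ ∀ k i j, δ * (A ^ (k + 1) *ᵥ x) i ≤ A i j * (A ^ k *ᵥ x) j := by
  obtain ⟨c, hc, h⟩ := exists_pos_mul_pow_mulVec_le hA hx
  have hs : ∀ i, 0 < ∑ l, A i l := fun i =>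
    Finset.sum_pos (fun l _ => hA i l) Finset.univ_nonempty
  obtain ⟨m, hm, h'⟩ := exists_pos_forall_le (f := fun p : n × n => A p.1 p.2 / ∑ l, A p.1 l)
    fun p => div_pos (hA _ _) (hs _)
  refine ⟨m * c, mul_pos hm hc, fun k i j => ?_⟩
  calc m * c * (A ^ (k + 1) *ᵥ x) i = m * ∑ l, A i l * (c * (A ^ k *ᵥ x) l) := by
        rw [pow_succ_mulVec, mul_assoc, mulVec, dotProduct, Finset.mul_sum]
        exact congrArg _ (Finset.sum_congr rfl fun l _ => by ring)
    _ ≤ m * ∑ l, A i l * (A ^ k *ᵥ x) j := by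
        gcongr with l
        · exact (hA i l).le
        · exact h k l j
    _ = m * (∑ l, A i l) * (A ^ k *ᵥ x) j := by rw [← Finset.sum_mul, mul_assoc]
    _ ≤ A i j * (A ^ k *ᵥ x) j := by
        gcongr
        · exact (pow_mulVec_pos hA hx k j).le
        · exact (le_div_iff₀ (hs i)).1 (h' (i, j))

variable {n : Type*} [Fintype n] [DecidableEq n] {A : Matrix n n ℝ} {x : n → ℝ}

theorem pow_succ_mulVec_le_aSeq (hA : ∀ i j, 0 < A i j) (hx : ∀ i, 0 < x i) (k : ℕ) (i : n) :
    (A ^ (k + 1) *ᵥ x) i ≤ aSeq A x (k + 1) * (A ^ k *ᵥ x) i := by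
  rw [← div_le_iff₀ (pow_mulVec_pos hA hx k i)]
  exact le_ciSup (f := fun i => (A ^ (k + 1) *ᵥ x) i / (A ^ k *ᵥ x) i)
    (Set.finite_range _).bddAbove i

theorem bSeq_le_pow_succ_mulVec (hA : ∀ i j, 0 < A i j) (hx : ∀ i, 0 < x i) (k : ℕ) (i : n) :
    bSeq A x (k + 1) * (A ^ k *ᵥ x) i ≤ (A ^ (k + 1) *ᵥ x) i := by
  rw [← le_div_iff₀ (pow_mulVec_pos hA hx k i)]
  exact ciInf_le (f := fun i => (A ^ (k + 1) *ᵥ x) i / (A ^ k *ᵥ x) i)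
    (Set.finite_range _).bddBelow i

variable [Nonempty n]

theorem exists_pow_succ_mulVec_eq_aSeq (hA : ∀ i j, 0 < A i j) (hx : ∀ i, 0 < x i) (k : ℕ) :
    ∃ i, (A ^ (k + 1) *ᵥ x) i = aSeq A x (k + 1) * (A ^ k *ᵥ x) i := by
  obtain ⟨i, hi⟩ := exists_eq_ciSup_of_finite (f := fun i => (A ^ (k + 1) *ᵥ x) i / (A ^ k *ᵥ x) i)
  exact ⟨i, (div_eq_iff (pow_mulVec_pos hA hx k i).ne').1 hi⟩

theorem exists_pow_succ_mulVec_eq_bSeq (hA : ∀ i j, 0 < A i j) (hx : ∀ i, 0 < x i) (k : ℕ) :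
    ∃ i, (A ^ (k + 1) *ᵥ x) i = bSeq A x (k + 1) * (A ^ k *ᵥ x) i := by
  obtain ⟨i, hi⟩ := exists_eq_ciInf_of_finite (f := fun i => (A ^ (k + 1) *ᵥ x) i / (A ^ k *ᵥ x) i)
  exact ⟨i, (div_eq_iff (pow_mulVec_pos hA hx k i).ne').1 hi⟩

theorem bSeq_le_aSeq (hA : ∀ i j, 0 < A i j) (hx : ∀ i, 0 < x i) (k : ℕ) :
    bSeq A x (k + 1) ≤ aSeq A x (k + 1) := by
  obtain ⟨i⟩ := ‹Nonempty n›
  exact le_of_mul_le_mul_right ((bSeq_le_pow_succ_mulVec hA hx k i).trans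
    (pow_succ_mulVec_le_aSeq hA hx k i)) (pow_mulVec_pos hA hx k i)

theorem aSeq_succ_lt (hA : ∀ i j, 0 < A i j) (hx : ∀ i, 0 < x i) {k : ℕ}
    (hk : A ^ (k + 1) *ᵥ x ≠ aSeq A x (k + 1) • (A ^ k *ᵥ x)) :
    aSeq A x (k + 2) < aSeq A x (k + 1) := by
  obtain ⟨i, hi⟩ := exists_pow_succ_mulVec_eq_aSeq hA hx (k + 1)
  have h := mulVec_apply_pos hA (u := aSeq A x (k + 1) • (A ^ k *ᵥ x) - A ^ (k + 1) *ᵥ x)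
    (fun i => sub_nonneg.2 (pow_succ_mulVec_le_aSeq hA hx k i)) (sub_ne_zero.2 hk.symm) i
  rw [mulVec_sub, mulVec_smul, ← pow_succ_mulVec, ← pow_succ_mulVec, Pi.sub_apply, Pi.smul_apply,
    smul_eq_mul, hi, sub_pos] at h
  exact lt_of_mul_lt_mul_right h (pow_mulVec_pos hA hx _ i).le

theorem lt_bSeq_succ (hA : ∀ i j, 0 < A i j) (hx : ∀ i, 0 < x i) {k : ℕ}
    (hk : A ^ (k + 1) *ᵥ x ≠ bSeq A x (k + 1) • (A ^ k *ᵥ x)) :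
    bSeq A x (k + 1) < bSeq A x (k + 2) := by
  obtain ⟨i, hi⟩ := exists_pow_succ_mulVec_eq_bSeq hA hx (k + 1)
  have h := mulVec_apply_pos hA (u := A ^ (k + 1) *ᵥ x - bSeq A x (k + 1) • (A ^ k *ᵥ x))
    (fun i => sub_nonneg.2 (bSeq_le_pow_succ_mulVec hA hx k i)) (sub_ne_zero.2 hk) i
  rw [mulVec_sub, mulVec_smul, ← pow_succ_mulVec, ← pow_succ_mulVec, Pi.sub_apply, Pi.smul_apply,
    smul_eq_mul, hi, sub_pos] at h
  exact lt_of_mul_lt_mul_right h (pow_mulVec_pos hA hx _ i).le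

/-- Covers the eigenvector case too, so the contraction below needs no assumption on Perron vectors.
-/
theorem bSeq_succ_mono (hA : ∀ i j, 0 < A i j) (hx : ∀ i, 0 < x i) (k : ℕ) :
    bSeq A x (k + 1) ≤ bSeq A x (k + 2) := by
  by_cases hk : A ^ (k + 1) *ᵥ x = bSeq A x (k + 1) • (A ^ k *ᵥ x)
  · obtain ⟨i, hi⟩ := exists_pow_succ_mulVec_eq_bSeq hA hx (k + 1)
    refine le_of_mul_le_mul_right (hi.le.trans' ?_) (pow_mulVec_pos hA hx (k + 1) i)
    rw [pow_succ_mulVec A x (k + 1), hk, mulVec_smul, ← pow_succ_mulVec, hk]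
    rfl
  · exact (lt_bSeq_succ hA hx hk).le

/-- One application of a positive matrix contracts the oscillation of the ratios by a uniform
factor. -/
theorem exists_aSeq_sub_bSeq_le (hA : ∀ i j, 0 < A i j) (hx : ∀ i, 0 < x i) :
    ∃ q, 0 ≤ q ∧ q < 1 ∧ ∀ k, aSeq A x (k + 2) - bSeq A x (k + 2) ≤
      q * (aSeq A x (k + 1) - bSeq A x (k + 1)) := by
  obtain ⟨δ, hδ, h⟩ := exists_pos_mul_pow_succ_mulVec_le hA hx
  refine ⟨max 0 (1 - δ), le_max_left _ _, max_lt one_pos (by linarith), fun k => ?_⟩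
  refine le_trans ?_ (mul_le_mul_of_nonneg_right (le_max_right 0 (1 - δ))
    (sub_nonneg.2 (bSeq_le_aSeq hA hx k)))
  have hb := bSeq_succ_mono hA hx k
  suffices aSeq A x (k + 2) ≤
      aSeq A x (k + 1) - δ * (aSeq A x (k + 1) - bSeq A x (k + 1)) by linarith
  obtain ⟨i, hi⟩ := exists_pow_succ_mulVec_eq_aSeq hA hx (k + 1)
  obtain ⟨j, hj⟩ := exists_pow_succ_mulVec_eq_bSeq hA hx k
  have hab := bSeq_le_aSeq hA hx k
  refine le_of_mul_le_mul_right ?_ (pow_mulVec_pos hA hx (k + 1) i)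
  -- Only the summand at `j`, where the old ratio is minimal, is kept; `δ` bounds its share of the
  -- new entry at `i`.
  have h₁ : A i j * (aSeq A x (k + 1) * (A ^ k *ᵥ x) j - (A ^ (k + 1) *ᵥ x) j) ≤
      (A *ᵥ (aSeq A x (k + 1) • (A ^ k *ᵥ x) - A ^ (k + 1) *ᵥ x)) i :=
    Finset.single_le_sum
      (f := fun j => A i j * (aSeq A x (k + 1) * (A ^ k *ᵥ x) j - (A ^ (k + 1) *ᵥ x) j))
      (fun l _ => mul_nonneg (hA i l).le (sub_nonneg.2 (pow_succ_mulVec_le_aSeq hA hx k l)))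
      (Finset.mem_univ j)
  rw [mulVec_sub, mulVec_smul, ← pow_succ_mulVec, ← pow_succ_mulVec, Pi.sub_apply, Pi.smul_apply,
    smul_eq_mul, hi, hj] at h₁
  have h₂ := mul_le_mul_of_nonneg_right (h k i j) (sub_nonneg.2 hab)
  linarith

theorem tendsto_aSeq_sub_bSeq (hA : ∀ i j, 0 < A i j) (hx : ∀ i, 0 < x i) :
    Tendsto (fun k => aSeq A x (k + 1) - bSeq A x (k + 1)) atTop (𝓝 0) := by
  obtain ⟨q, hq, hq1, h⟩ := exists_aSeq_sub_bSeq_le hA hx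
  refine squeeze_zero (fun k => sub_nonneg.2 (bSeq_le_aSeq hA hx k))
    (g := fun k => q ^ k * (aSeq A x 1 - bSeq A x 1)) (fun k => ?_) ?_
  · induction k with
    | zero => simp
    | succ k ih =>
      calc _ ≤ _ := h k
        _ ≤ q * (q ^ k * (aSeq A x 1 - bSeq A x 1)) := mul_le_mul_of_nonneg_left ih hq
        _ = _ := by ring
  · simpa using (tendsto_pow_atTop_nhds_zero_of_lt_one hq hq1).mul_const _

end PositiveMatrix

/-! ### Perron value, limits and strict monotonicity for symmetric matrices. -/

section SymmetricMatrix

variable {n : Type*} [Fintype n] [DecidableEq n] {A : Matrix n n ℝ}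

/-- Pair `‖μ‖ |u| ≤ A |u|` with `y`; symmetry moves `A` onto `y`. -/
theorem norm_le_of_mem_spectrum_of_mulVec_le (hA : ∀ i j, 0 < A i j) (hs : A.IsSymm)
    {y : n → ℝ} (hy : ∀ i, 0 < y i) {a : ℝ} (h : ∀ i, (A *ᵥ y) i ≤ a * y i)
    {μ : ℂ} (hμ : μ ∈ spectrum ℂ (A.map (algebraMap ℝ ℂ))) : ‖μ‖ ≤ a := by
  rw [← spectrum_toLin', ← Module.End.hasEigenvalue_iff_mem_spectrum] at hμ
  obtain ⟨u, hu⟩ := hμ.exists_hasEigenvector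
  have hu' : A.map (algebraMap ℝ ℂ) *ᵥ u = μ • u := hu.apply_eq_smul
  obtain ⟨i₀, hi₀⟩ := Function.ne_iff.1 hu.2
  have hle : ∀ i, ‖μ‖ * ‖u i‖ ≤ (A *ᵥ fun j => ‖u j‖) i := fun i => by
    rw [← norm_mul, ← smul_eq_mul, ← Pi.smul_apply, ← hu']
    refine (norm_sum_le _ _).trans (Finset.sum_le_sum fun j _ => ?_)
    simp [abs_of_pos (hA i j)]
  have hpos : 0 < y ⬝ᵥ fun j => ‖u j‖ :=
    Finset.sum_pos' (fun i _ => mul_nonneg (hy i).le (norm_nonneg _))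
      ⟨i₀, Finset.mem_univ _, mul_pos (hy i₀) (norm_pos_iff.2 hi₀)⟩
  refine le_of_mul_le_mul_right ?_ hpos
  calc ‖μ‖ * (y ⬝ᵥ fun j => ‖u j‖) = ∑ i, y i * (‖μ‖ * ‖u i‖) := by
        rw [dotProduct, Finset.mul_sum]; exact Finset.sum_congr rfl fun i _ => by ring
    _ ≤ y ⬝ᵥ A *ᵥ fun j => ‖u j‖ :=
        Finset.sum_le_sum fun i _ => mul_le_mul_of_nonneg_left (hle i) (hy i).le
    _ = (A *ᵥ y) ⬝ᵥ fun j => ‖u j‖ := by rw [dotProduct_mulVec, ← mulVec_transpose, hs.eq]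
    _ ≤ ∑ i, a * y i * ‖u i‖ :=
        Finset.sum_le_sum fun i _ => mul_le_mul_of_nonneg_right (h i) (norm_nonneg _)
    _ = a * (y ⬝ᵥ fun j => ‖u j‖) := by
        rw [dotProduct, Finset.mul_sum]; exact Finset.sum_congr rfl fun i _ => by ring

theorem spectralRadius_le_of_mulVec_le (hA : ∀ i j, 0 < A i j) (hs : A.IsSymm)
    {y : n → ℝ} (hy : ∀ i, 0 < y i) {a : ℝ} (h : ∀ i, (A *ᵥ y) i ≤ a * y i) :
    spectralRadius ℂ (A.map (algebraMap ℝ ℂ)) ≤ ENNReal.ofReal a := by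
  refine iSup₂_le fun μ hμ => ?_
  rw [← enorm_eq_nnnorm, ← ofReal_norm]
  exact ENNReal.ofReal_le_ofReal (norm_le_of_mem_spectrum_of_mulVec_le hA hs hy h hμ)

theorem perronValue_le_of_mulVec_le [Nonempty n] (hA : ∀ i j, 0 < A i j) (hs : A.IsSymm)
    {y : n → ℝ} (hy : ∀ i, 0 < y i) {a : ℝ} (h : ∀ i, (A *ᵥ y) i ≤ a * y i) :
    perronValue A ≤ a := by
  obtain ⟨i⟩ := ‹Nonempty n›
  have ha : 0 ≤ a := by
    have := mulVec_apply_pos hA (fun i => (hy i).le) (fun h => (hy i).ne' (congrFun h i)) i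
    exact (pos_of_mul_pos_left (this.trans_le (h i)) (hy i).le).le
  exact ENNReal.toReal_le_of_le_ofReal ha (spectralRadius_le_of_mulVec_le hA hs hy h)

/-- Needed because `toReal` sends `⊤` to `0`. -/
theorem spectralRadius_map_ne_top (A : Matrix n n ℝ) :
    spectralRadius ℂ (A.map (algebraMap ℝ ℂ)) ≠ ⊤ := by
  obtain ⟨C, hC⟩ := (finite_spectrum (A.map (algebraMap ℝ ℂ))).isBounded.exists_norm_le
  refine ((iSup₂_le fun μ hμ => ?_).trans_lt (ENNReal.ofReal_lt_top (r := C))).ne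
  rw [← enorm_eq_nnnorm, ← ofReal_norm]
  exact ENNReal.ofReal_le_ofReal (hC μ hμ)

theorem abs_le_perronValue {u : n → ℝ} (hu : u ≠ 0) {t : ℝ} (h : A *ᵥ u = t • u) :
    |t| ≤ perronValue A := by
  have hmem : (t : ℂ) ∈ spectrum ℂ (A.map (algebraMap ℝ ℂ)) := by
    rw [← spectrum_toLin', ← Module.End.hasEigenvalue_iff_mem_spectrum]
    refine Module.End.hasEigenvalue_of_hasEigenvector (x := algebraMap ℝ ℂ ∘ u)
      (Module.End.hasEigenvector_iff.2 ⟨Module.End.mem_eigenspace_iff.2 ?_, fun h0 => hu ?_⟩)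
    · ext i
      have := (RingHom.map_mulVec (algebraMap ℝ ℂ) A u i).symm
      rw [h] at this
      simpa using this
    · ext i
      simpa using congrFun h0 i
  have := ENNReal.toReal_mono (spectralRadius_map_ne_top A)
    (le_iSup₂ (f := fun (k : ℂ) (_ : k ∈ spectrum ℂ (A.map (algebraMap ℝ ℂ))) => (‖k‖₊ : ENNReal))
      (t : ℂ) hmem)
  simpa [perronValue] using this

/-- An eigenvalue `s` of `ρ - A` yields the eigenvalue `ρ - s ≤ ρ` of `A`, so `ρ - A` is positive
semidefinite. -/
theorem dotProduct_mulVec_le_perronValue (hs : A.IsSymm) (y : n → ℝ) :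
    y ⬝ᵥ A *ᵥ y ≤ perronValue A * (y ⬝ᵥ y) := by
  have hH : (perronValue A • (1 : Matrix n n ℝ) - A).IsHermitian := by
    rw [IsHermitian, conjTranspose_eq_transpose_of_trivial]
    simp [hs.eq]
  have hP : (perronValue A • (1 : Matrix n n ℝ) - A).PosSemidef := by
    refine hH.posSemidef_iff_eigenvalues_nonneg.2 fun i => ?_
    have h := hH.mulVec_eigenvectorBasis i
    have hne : (hH.eigenvectorBasis i).ofLp ≠ 0 := fun h0 =>
      hH.eigenvectorBasis.orthonormal.ne_zero i (by ext j; simpa using congrFun h0 j)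
    have h' : A *ᵥ (hH.eigenvectorBasis i).ofLp =
        (perronValue A - hH.eigenvalues i) • (hH.eigenvectorBasis i).ofLp := by
      rw [sub_smul, ← h, sub_mulVec, smul_mulVec, one_mulVec, sub_sub_cancel]
    simpa using (le_abs_self _).trans (abs_le_perronValue hne h')
  have := hP.dotProduct_mulVec_nonneg y
  rw [sub_mulVec, smul_mulVec, one_mulVec, dotProduct_sub, dotProduct_smul] at this
  simpa using this

theorem le_perronValue_of_le_mulVec [Nonempty n] (hs : A.IsSymm)
    {y : n → ℝ} (hy : ∀ i, 0 < y i) {b : ℝ} (h : ∀ i, b * y i ≤ (A *ᵥ y) i) :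
    b ≤ perronValue A := by
  have hpos : 0 < y ⬝ᵥ y :=
    Finset.sum_pos (fun i _ => mul_pos (hy i) (hy i)) Finset.univ_nonempty
  refine le_of_mul_le_mul_right ?_ hpos
  refine le_trans ?_ (dotProduct_mulVec_le_perronValue hs y)
  rw [dotProduct, dotProduct, Finset.mul_sum]
  exact Finset.sum_le_sum fun i _ => by
    rw [mul_left_comm]; exact mul_le_mul_of_nonneg_left (h i) (hy i).le

variable [Nonempty n] {x : n → ℝ}

theorem perronValue_le_aSeq (hA : ∀ i j, 0 < A i j) (hs : A.IsSymm) (hx : ∀ i, 0 < x i) (k : ℕ) :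
    perronValue A ≤ aSeq A x (k + 1) :=
  perronValue_le_of_mulVec_le hA hs (pow_mulVec_pos hA hx k) fun i => by
    rw [← pow_succ_mulVec]; exact pow_succ_mulVec_le_aSeq hA hx k i

theorem bSeq_le_perronValue (hA : ∀ i j, 0 < A i j) (hs : A.IsSymm) (hx : ∀ i, 0 < x i) (k : ℕ) :
    bSeq A x (k + 1) ≤ perronValue A :=
  le_perronValue_of_le_mulVec hs (pow_mulVec_pos hA hx k) fun i => by
    rw [← pow_succ_mulVec]; exact bSeq_le_pow_succ_mulVec hA hx k i

theorem tendsto_aSeq (hA : ∀ i j, 0 < A i j) (hs : A.IsSymm) (hx : ∀ i, 0 < x i) :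
    Tendsto (aSeq A x) atTop (𝓝 (perronValue A)) := by
  rw [← tendsto_add_atTop_iff_nat 1, tendsto_iff_dist_tendsto_zero]
  refine squeeze_zero (fun _ => dist_nonneg) (fun k => ?_) (tendsto_aSeq_sub_bSeq hA hx)
  have h₁ := perronValue_le_aSeq hA hs hx k
  have h₂ := bSeq_le_perronValue hA hs hx k
  rw [Real.dist_eq, abs_of_nonneg (by linarith)]
  linarith

theorem tendsto_bSeq (hA : ∀ i j, 0 < A i j) (hs : A.IsSymm) (hx : ∀ i, 0 < x i) :
    Tendsto (bSeq A x) atTop (𝓝 (perronValue A)) := by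
  rw [← tendsto_add_atTop_iff_nat 1]
  simpa using ((tendsto_add_atTop_iff_nat 1).2 (tendsto_aSeq hA hs hx)).sub
    (tendsto_aSeq_sub_bSeq hA hx)

theorem dotProduct_pow_mulVec_pos (hA : ∀ i j, 0 < A i j) (hx : ∀ i, 0 < x i) (k : ℕ) :
    0 < x ⬝ᵥ A ^ k *ᵥ x :=
  Finset.sum_pos (fun i _ => mul_pos (hx i) (pow_mulVec_pos hA hx k i)) Finset.univ_nonempty

theorem cSeq_le_aSeq (hA : ∀ i j, 0 < A i j) (hx : ∀ i, 0 < x i) (k : ℕ) :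
    cSeq A x (k + 1) ≤ aSeq A x (k + 1) := by
  refine (div_le_iff₀ (dotProduct_pow_mulVec_pos hA hx k)).2 ?_
  change _ ≤ _ * (x ⬝ᵥ A ^ k *ᵥ x)
  rw [← smul_eq_mul, ← dotProduct_smul]
  exact Finset.sum_le_sum fun i _ =>
    mul_le_mul_of_nonneg_left (pow_succ_mulVec_le_aSeq hA hx k i) (hx i).le

theorem bSeq_le_cSeq (hA : ∀ i j, 0 < A i j) (hx : ∀ i, 0 < x i) (k : ℕ) :
    bSeq A x (k + 1) ≤ cSeq A x (k + 1) := by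
  refine (le_div_iff₀ (dotProduct_pow_mulVec_pos hA hx k)).2 ?_
  change _ * (x ⬝ᵥ A ^ k *ᵥ x) ≤ _
  rw [← smul_eq_mul, ← dotProduct_smul]
  exact Finset.sum_le_sum fun i _ =>
    mul_le_mul_of_nonneg_left (bSeq_le_pow_succ_mulVec hA hx k i) (hx i).le

theorem tendsto_cSeq (hA : ∀ i j, 0 < A i j) (hs : A.IsSymm) (hx : ∀ i, 0 < x i) :
    Tendsto (cSeq A x) atTop (𝓝 (perronValue A)) := by
  rw [← tendsto_add_atTop_iff_nat 1]
  exact tendsto_of_tendsto_of_tendsto_of_le_of_le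
    ((tendsto_add_atTop_iff_nat 1).2 (tendsto_bSeq hA hs hx))
    ((tendsto_add_atTop_iff_nat 1).2 (tendsto_aSeq hA hs hx))
    (bSeq_le_cSeq hA hx) (cSeq_le_aSeq hA hx)

theorem isPerronVector_of_mulVec_eq (hA : ∀ i j, 0 < A i j) (hs : A.IsSymm) (hx : ∀ i, 0 < x i)
    {t : ℝ} (h : A *ᵥ x = t • x) : IsPerronVector A x := by
  have ht : perronValue A = t :=
    le_antisymm (perronValue_le_of_mulVec_le hA hs hx fun i => (congrFun h i).le)
      (le_perronValue_of_le_mulVec hs hx fun i => (congrFun h i).ge)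
  refine Module.End.hasEigenvector_iff.2 ⟨Module.End.mem_eigenspace_iff.2 ?_, fun h0 => ?_⟩
  · rw [toLin'_apply, h, ht]
  · obtain ⟨i⟩ := ‹Nonempty n›
    exact (hx i).ne' (congrFun h0 i)

theorem pow_succ_mulVec_ne_smul (hA : ∀ i j, 0 < A i j) (hP : A.PosDef) (hx : ∀ i, 0 < x i)
    (hxP : ¬ IsPerronVector A x) (k : ℕ) (t : ℝ) : A ^ (k + 1) *ᵥ x ≠ t • (A ^ k *ᵥ x) := by
  intro h
  refine hxP (isPerronVector_of_mulVec_eq hA hP.isHermitian hx (t := t) ?_)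
  refine mulVec_injective_iff_isUnit.2 (hP.isUnit.pow k) ?_
  rw [mulVec_mulVec, ← pow_succ, h, mulVec_smul]

theorem cSeq_lt_succ (hA : ∀ i j, 0 < A i j) (hP : A.PosDef) (hx : ∀ i, 0 < x i)
    (hxP : ¬ IsPerronVector A x) (k : ℕ) : cSeq A x (k + 1) < cSeq A x (k + 2) := by
  have hs : A.IsSymm := hP.isHermitian
  have hPk : (A ^ k).PosDef := (hP.posSemidef.pow k).posDef_iff_isUnit.2 (hP.isUnit.pow k)
  have h₀ := dotProduct_pow_mulVec_pos hA hx k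
  have h₁ := dotProduct_pow_mulVec_pos hA hx (k + 1)
  -- This `t` minimises the `A ^ k`-form of `A x - t x`; positivity of that minimum is the claim.
  set t := (x ⬝ᵥ A ^ (k + 1) *ᵥ x) / (x ⬝ᵥ A ^ k *ᵥ x) with ht
  have hne : A *ᵥ x - t • x ≠ 0 := fun h => by
    have := pow_succ_mulVec_ne_smul hA hP hx hxP 0 t
    simp only [zero_add, pow_one, pow_zero, one_mulVec] at this
    exact this (sub_eq_zero.1 h)
  have h := hPk.dotProduct_mulVec_pos hne
  have hmove : ∀ z, (A *ᵥ x) ⬝ᵥ z = x ⬝ᵥ A *ᵥ z := fun z => by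
    rw [dotProduct_mulVec, ← mulVec_transpose, hs.eq]
  have e₁ : A ^ k *ᵥ (A *ᵥ x) = A ^ (k + 1) *ᵥ x := by rw [mulVec_mulVec, ← pow_succ]
  rw [star_trivial, mulVec_sub, mulVec_smul, e₁, sub_dotProduct, dotProduct_sub, dotProduct_sub,
    hmove, ← pow_succ_mulVec, smul_dotProduct, smul_dotProduct, dotProduct_smul, dotProduct_smul,
    hmove, ← pow_succ_mulVec] at h
  simp only [smul_eq_mul] at h
  have hts : t * (x ⬝ᵥ A ^ k *ᵥ x) = x ⬝ᵥ A ^ (k + 1) *ᵥ x := div_mul_cancel₀ _ h₀.ne'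
  rw [hts, sub_self, sub_zero, sub_pos] at h
  exact (lt_div_iff₀ h₁).2 h

theorem strictAntiOn_aSeq (hA : ∀ i j, 0 < A i j) (hP : A.PosDef) (hx : ∀ i, 0 < x i)
    (hxP : ¬ IsPerronVector A x) : StrictAntiOn (aSeq A x) (Set.Ici 1) := by
  refine strictAntiOn_of_succ_lt Set.ordConnected_Ici fun k _ hk _ => ?_
  -- Index `k + 1` avoids the truncated `k - 1`, which at index `0` gives the ratio `1`.
  obtain ⟨k, rfl⟩ := Nat.exists_eq_add_of_le' hk
  exact aSeq_succ_lt hA hx (pow_succ_mulVec_ne_smul hA hP hx hxP k _)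

theorem strictMonoOn_bSeq (hA : ∀ i j, 0 < A i j) (hP : A.PosDef) (hx : ∀ i, 0 < x i)
    (hxP : ¬ IsPerronVector A x) : StrictMonoOn (bSeq A x) (Set.Ici 1) := by
  refine strictMonoOn_of_lt_succ Set.ordConnected_Ici fun k _ hk _ => ?_
  obtain ⟨k, rfl⟩ := Nat.exists_eq_add_of_le' hk
  exact lt_bSeq_succ hA hx (pow_succ_mulVec_ne_smul hA hP hx hxP k _)

theorem strictMonoOn_cSeq (hA : ∀ i j, 0 < A i j) (hP : A.PosDef) (hx : ∀ i, 0 < x i)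
    (hxP : ¬ IsPerronVector A x) : StrictMonoOn (cSeq A x) (Set.Ici 1) := by
  refine strictMonoOn_of_lt_succ Set.ordConnected_Ici fun k _ hk _ => ?_
  obtain ⟨k, rfl⟩ := Nat.exists_eq_add_of_le' hk
  exact cSeq_lt_succ hA hP hx hxP k

end SymmetricMatrix

/-! ### Positivity and definiteness of the bottleneck matrix. -/

section Laplacian

variable {V : Type*} [Fintype V] [DecidableEq V] (G : SimpleGraph V) [DecidableRel G.Adj]
  (w : Sym2 V → ℝ)

theorem weightedLaplacian_mulVec (u : V → ℝ) (i : V) :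
    (weightedLaplacian G w *ᵥ u) i = ∑ j ∈ G.neighborFinset i, w s(i, j) * (u i - u j) := by
  have h : ∀ j, weightedLaplacian G w i j * u j =
      (if i = j then (∑ l ∈ G.neighborFinset i, w s(i, l)) * u j else 0) -
        if G.Adj i j then w s(i, j) * u j else 0 := fun j => by
    by_cases hij : i = j
    · subst hij; simp [weightedLaplacian]
    · by_cases ha : G.Adj i j <;> simp [weightedLaplacian, hij, ha]
  rw [mulVec, dotProduct, Finset.sum_congr rfl fun j _ => h j, Finset.sum_sub_distrib,
    Finset.sum_ite_eq, if_pos (Finset.mem_univ i), ← Finset.sum_filter,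
    ← SimpleGraph.neighborFinset_eq_filter, Finset.sum_mul, ← Finset.sum_sub_distrib]
  exact Finset.sum_congr rfl fun j _ => by ring

theorem weightedLaplacian_isSymm : (weightedLaplacian G w).IsSymm := by
  ext i j
  by_cases hij : i = j
  · subst hij; rfl
  · simp [weightedLaplacian, hij, Ne.symm hij, G.adj_comm, Sym2.eq_swap]

variable {G w}

theorem weightedLaplacian_posSemidef (hw : ∀ e ∈ G.edgeSet, 0 < w e) :
    (weightedLaplacian G w).PosSemidef := by
  refine .of_dotProduct_mulVec_nonneg (weightedLaplacian_isSymm G w) fun u => ?_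
  have h : star u ⬝ᵥ weightedLaplacian G w *ᵥ u =
      ∑ i, ∑ j, if G.Adj i j then w s(i, j) * (u i * (u i - u j)) else 0 := by
    refine Finset.sum_congr rfl fun i _ => ?_
    rw [weightedLaplacian_mulVec, ← Finset.sum_filter, ← SimpleGraph.neighborFinset_eq_filter,
      Finset.mul_sum]
    exact Finset.sum_congr rfl fun j _ => by simp; ring
  have h' : star u ⬝ᵥ weightedLaplacian G w *ᵥ u =
      ∑ i, ∑ j, if G.Adj i j then w s(i, j) * (u j * (u j - u i)) else 0 := by
    rw [h, Finset.sum_comm]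
    exact Finset.sum_congr rfl fun i _ => Finset.sum_congr rfl fun j _ => by
      simp only [G.adj_comm j i, Sym2.eq_swap (a := j)]
  -- Adding the two forms, which differ by swapping `i` and `j`, produces the squares `w (u i - u j)
  -- ^ 2`.
  have h2 : 0 ≤ star u ⬝ᵥ weightedLaplacian G w *ᵥ u + star u ⬝ᵥ weightedLaplacian G w *ᵥ u := by
    nth_rw 1 [h]
    rw [h', ← Finset.sum_add_distrib]
    refine Finset.sum_nonneg fun i _ => ?_
    rw [← Finset.sum_add_distrib]
    refine Finset.sum_nonneg fun j _ => ?_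
    split_ifs with ha
    · have := mul_nonneg (hw s(i, j) ha).le (sq_nonneg (u i - u j))
      linarith
    · simp
  linarith

variable {v : V}

/-- The value at `i` of the Laplacian with row and column `v` deleted, applied to `u`. -/
theorem submatrix_weightedLaplacian_mulVec (u : {i // i ≠ v} → ℝ) (i : {i // i ≠ v}) :
    ((weightedLaplacian G w).submatrix Subtype.val Subtype.val *ᵥ u) i =
      ∑ j ∈ G.neighborFinset i,
        w s(i.1, j) * (u i - if h : j ≠ v then u ⟨j, h⟩ else 0) := by
  have h := weightedLaplacian_mulVec G w (fun j => if h : j ≠ v then u ⟨j, h⟩ else 0) i.1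
  simp only [dif_pos i.2, Subtype.coe_eta] at h
  rw [← h, mulVec, dotProduct, mulVec, dotProduct,
    Fintype.sum_eq_add_sum_subtype_ne _ v, dif_neg (by simp), mul_zero, zero_add]
  exact Finset.sum_congr rfl fun j _ => by simp [j.2]

/-- Minimum principle. -/
theorem eq_zero_or_pos_of_nonneg (hG : G.Connected) [Nontrivial V] (hw : ∀ e ∈ G.edgeSet, 0 < w e)
    (hv : ¬ IsCutVertex G v) {u : {i // i ≠ v} → ℝ}
    (hu : ∀ i : {i // i ≠ v},
      0 ≤ ((weightedLaplacian G w).submatrix Subtype.val Subtype.val *ᵥ u) i) :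
    u = 0 ∨ ∀ i, 0 < u i := by
  have hne : Nonempty {i // i ≠ v} := nonempty_subtype.2 (exists_ne v)
  obtain ⟨m, hm⟩ := Finite.exists_min u
  rcases lt_or_ge 0 (u m) with h0 | h0
  · exact .inr fun i => h0.trans_le (hm i)
  left
  -- With `u` extended by `0` at `v`, each term of the row sum at a nonpositive minimum is `≤ 0`,
  -- while the sum is `≥ 0`: all neighbours share the minimum.
  have hnbr : ∀ i, u i = u m → ∀ j, G.Adj i.1 j →
      (if h : j ≠ v then u ⟨j, h⟩ else 0) = u m := by
    intro i hi j hj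
    have hle : ∀ l, u i ≤ if h : l ≠ v then u ⟨l, h⟩ else 0 := fun l => by
      split_ifs with h
      · exact hi.le.trans (hm _)
      · exact hi.le.trans h0
    have hsum := hu i
    rw [submatrix_weightedLaplacian_mulVec] at hsum
    have hterm : ∀ l ∈ G.neighborFinset i.1,
        w s(i.1, l) * (u i - if h : l ≠ v then u ⟨l, h⟩ else 0) ≤ 0 := fun l hl =>
      mul_nonpos_of_nonneg_of_nonpos (hw s(i.1, l) ((G.mem_neighborFinset _ _).1 hl)).le
        (sub_nonpos.2 (hle l))
    have := (Finset.sum_eq_zero_iff_of_nonpos hterm).1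
      (le_antisymm (Finset.sum_nonpos hterm) hsum) j ((G.mem_neighborFinset _ _).2 hj)
    have := (mul_eq_zero.1 this).resolve_left (hw s(i.1, j) hj).ne'
    rw [← hi]
    linarith
  have hconst : ∀ i, u i = u m := by
    intro i
    have : Subsingleton (G.induce {u | u ≠ v}).ConnectedComponent :=
      not_nontrivial_iff_subsingleton.1 hv
    obtain ⟨p⟩ : (G.induce {u | u ≠ v}).Reachable m i :=
      SimpleGraph.ConnectedComponent.exact (Subsingleton.elim _ _)
    have key : ∀ {a b : {u | u ≠ v}}, (G.induce {u | u ≠ v}).Walk a b → u a = u m → u b = u m := by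
      intro a b p
      induction p with
      | nil => exact id
      | @cons a c b hac _ ih =>
        intro ha
        have := hnbr a ha c.1 hac
        rw [dif_pos (show c.1 ≠ v from c.2)] at this
        exact ih this
    exact key p rfl
  -- A neighbour of `v` ties the constant to the boundary value `0`.
  obtain ⟨i, hi⟩ := hG.preconnected.exists_adj_of_nontrivial v
  have := hnbr ⟨i, hi.ne'⟩ (hconst _) v hi.symm
  rw [dif_neg (by simp)] at this
  ext j
  rw [hconst j, ← this, Pi.zero_apply]

/-- A kernel vector and its negative both obey the minimum principle, and cannot both be positive.
-/
theorem isUnit_submatrix_weightedLaplacian (hG : G.Connected) [Nontrivial V]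
    (hw : ∀ e ∈ G.edgeSet, 0 < w e) (hv : ¬ IsCutVertex G v) :
    IsUnit ((weightedLaplacian G w).submatrix (Subtype.val : {i // i ≠ v} → V)
      (Subtype.val : {i // i ≠ v} → V)) := by
  refine mulVec_injective_iff_isUnit.1 fun y z hyz => ?_
  have hne : Nonempty {i // i ≠ v} := nonempty_subtype.2 (exists_ne v)
  obtain ⟨i⟩ := hne
  replace hyz : _ *ᵥ y = _ *ᵥ z := hyz
  have h₁ := eq_zero_or_pos_of_nonneg hG hw hv (u := y - z) (by simp [mulVec_sub, hyz])
  have h₂ := eq_zero_or_pos_of_nonneg hG hw hv (u := z - y) (by simp [mulVec_sub, hyz])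
  rcases h₁ with h₁ | h₁
  · exact sub_eq_zero.1 h₁
  rcases h₂ with h₂ | h₂
  · exact (sub_eq_zero.1 h₂).symm
  · have := h₁ i
    have := h₂ i
    simp only [Pi.sub_apply] at *
    linarith

theorem bottleneckMatrix_posDef (hG : G.Connected) [Nontrivial V]
    (hw : ∀ e ∈ G.edgeSet, 0 < w e) (hv : ¬ IsCutVertex G v) : (bottleneckMatrix G w v).PosDef :=
  PosDef.inv ((((weightedLaplacian_posSemidef hw).submatrix _).posDef_iff_isUnit).2
    (isUnit_submatrix_weightedLaplacian hG hw hv))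

theorem bottleneckMatrix_pos (hG : G.Connected) [Nontrivial V]
    (hw : ∀ e ∈ G.edgeSet, 0 < w e) (hv : ¬ IsCutVertex G v) (i j : {u // u ≠ v}) :
    0 < bottleneckMatrix G w v i j := by
  have hdet := (isUnit_iff_isUnit_det _).1 (isUnit_submatrix_weightedLaplacian hG hw hv)
  have hcol : (weightedLaplacian G w).submatrix Subtype.val Subtype.val *ᵥ
      (bottleneckMatrix G w v *ᵥ Pi.single j 1) = Pi.single j 1 := by
    rw [mulVec_mulVec, bottleneckMatrix, mul_nonsing_inv _ hdet, one_mulVec]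
  rcases eq_zero_or_pos_of_nonneg hG hw hv (u := bottleneckMatrix G w v *ᵥ Pi.single j 1)
    (fun i => by rw [hcol, Pi.single_apply]; split_ifs <;> norm_num) with h | h
  · rw [h, mulVec_zero] at hcol
    simpa using congrFun hcol j
  · simpa using h i

end Laplacian

theorem mainTheorem7 {V : Type*} [Fintype V] [DecidableEq V] [Nontrivial V]
    (G : SimpleGraph V) [DecidableRel G.Adj] (hG : G.Connected)
    (w : Sym2 V → ℝ) (hw : ∀ e ∈ G.edgeSet, 0 < w e)
    (v : V) (hv : ¬ IsCutVertex G v)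
    (x : {u // u ≠ v} → ℝ) (hx : ∀ i, 0 < x i)
    (hxP : ¬ IsPerronVector (bottleneckMatrix G w v) x) :
    (StrictAntiOn (aSeq (bottleneckMatrix G w v) x) (Set.Ici 1) ∧
      Tendsto (aSeq (bottleneckMatrix G w v) x) atTop
        (𝓝 (perronValue (bottleneckMatrix G w v)))) ∧
    (StrictMonoOn (bSeq (bottleneckMatrix G w v) x) (Set.Ici 1) ∧
      Tendsto (bSeq (bottleneckMatrix G w v) x) atTop
        (𝓝 (perronValue (bottleneckMatrix G w v)))) ∧
    (StrictMonoOn (cSeq (bottleneckMatrix G w v) x) (Set.Ici 1) ∧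
      Tendsto (cSeq (bottleneckMatrix G w v) x) atTop
        (𝓝 (perronValue (bottleneckMatrix G w v)))) := by
  have hA := bottleneckMatrix_pos hG hw hv
  have hP := bottleneckMatrix_posDef hG hw hv
  have hs : (bottleneckMatrix G w v).IsSymm := hP.isHermitian
  have hne : Nonempty {u // u ≠ v} := nonempty_subtype.2 (exists_ne v)
  exact ⟨⟨strictAntiOn_aSeq hA hP hx hxP, tendsto_aSeq hA hs hx⟩,
    ⟨strictMonoOn_bSeq hA hP hx hxP, tendsto_bSeq hA hs hx⟩,
    strictMonoOn_cSeq hA hP hx hxP, tendsto_cSeq hA hs hx⟩
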